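/- Conventions. For a metric space $T$, a point $a\in T$ and non-empty $X,Y\subset T$ put $|aX|=\inf_{x\in X}|ax|$, $B_r(X)=\{a\in T:|aX|\le r\}$ for $r\ge 0$, $\overrightarrow{d_H}(Y,X)=\sup_{a\in Y}|aX|$, and let $d_H$ be the Hausdorff distance, $d_H(X,Y)=\max\{\overrightarrow{d_H}(X,Y),\overrightarrow{d_H}(Y,X)\}\in[0,\infty]$. The Gromov–Hausdorff distance $d_{GH}(X,Y)\in[0,\infty]$ of non-empty metric spaces is half of the infimum of the distortions $\sup\{\,\bigl||xx'|-|yy'|\bigr|:(x,y),(x',y')\in R\}$ over all correspondences $R\subset X\times Y$ (relations whose projections to $X$ and to $Y$ are surjective). Non-empty metric spaces at zero Gromov–Hausdorff distance are identified; the cloud $[T]$ consists of all (classes of) metric spaces $Y$ with $d_{GH}(Y,T)<\infty$, and $d_{GH}$ is a metric on it. A metric tree is a space obtained from a disjoint union of non-degenerate segments of the real line by identifying some of their ends, such that the resulting graph (its vertices are the images of the ends of the segments, its edges the images of the segments) is connected and has no cycles, with the intrinsic metric induced by the lengths of the segments; there may be infinitely many edges. For a non-empty $X\subset T$, let $\partial_XT$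 be the set of those points $a\in T\setminus X$ through which there passes no path in $T$ (topological embedding of a segment) with both ends in $X$. If $d=d_H(X,T)<\infty$, the canonical Hausdorff geodesic from $X$ to $T$ is $t\mapsto C_t=B_t(X)\cap B_{d-t}(T)$, $t\in[0,d]$, where each $C_t$ carries the metric induced from $T$. Statement. Let $T$ be a metric tree all of whose vertices have finite degree, and let $X$ be a non-empty closed subset of $T$ with $d_H(X,T)<\infty$ such that either $\partial_XT=\emptyset$, or $\partial_XT\ne\emptyset$ and $d_H(X,T)>\overrightarrow{d_H}(\partial_XT,X)$. Then the canonical Hausdorff geodesic $t\mapsto C_t$, $t\in[0,d_H(X,T)]$, is a shortest curve in the cloud $[T]$ joining $X$ to $T$: all $C_t$ are non-empty and belong to $[T]$, $C_0=X$ and $C_d=T$ as elements of $[T]$, the curve is continuous with respect to $d_{GH}$, its length with respect to $d_{GH}$ equals $d_{GH}(X,T)$, and hence no curve in $[T]$ joining $X$ to $T$ is shorter. -/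

import Mathlib

open Set Metric
open scoped ENNReal

universe u v

/-! ### Hausdorff-type distances -/

/-- The oriented Hausdorff distance `sup_{a ∈ A} |aB|` (it is `0` for empty `A`). -/
noncomputable def orientedHausdorffEDist {Z : Type u} [MetricSpace Z] (A B : Set Z) : ℝ≥0∞ :=
  ⨆ a ∈ A, infEDist a B

/-- The canonical Hausdorff geodesic `C_t = B_t(A) ∩ B_{d-t}(B)`, `d = d_H(A, B)`, between subsets
`A`, `B` at finite Hausdorff distance; here `cthickening r A = {x | |xA| ≤ r}` is the closed
`r`-neighbourhood. It is meant for `t ∈ [0, d]`. -/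
noncomputable def canonicalHausdorffGeodesic {Z : Type u} [MetricSpace Z] (A B : Set Z) (t : ℝ) :
    Set Z :=
  cthickening t A ∩ cthickening (hausdorffDist A B - t) B

/-! ### The Gromov–Hausdorff class and its clouds -/

/-- Non-empty metric spaces. -/
structure MetricSp : Type (u + 1) where
  carrier : Type u
  [metric : MetricSpace carrier]
  [nonempty : Nonempty carrier]

attribute [instance] MetricSp.metric MetricSp.nonempty

/-- A non-empty subset of a metric space, as a metric space. -/
def MetricSp.ofSet {Z : Type u} [MetricSpace Z] (S : Set Z) (h : S.Nonempty) : MetricSp.{u} :=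
  haveI : Nonempty S := h.to_subtype
  ⟨S⟩

/-- Correspondences: relations that are total and surjective. -/
def IsCorrespondence {X : Type u} {Y : Type v} (R : Set (X × Y)) : Prop :=
  (∀ x, ∃ y, (x, y) ∈ R) ∧ (∀ y, ∃ x, (x, y) ∈ R)

/-- The distortion `sup { ||xx'| - |yy'|| : (x, y), (x', y') ∈ R }` in `[0, ∞]`. -/
noncomputable def distortion {X : Type u} {Y : Type v} [MetricSpace X] [MetricSpace Y]
    (R : Set (X × Y)) : ℝ≥0∞ :=
  ⨆ p ∈ R, ⨆ q ∈ R, ENNReal.ofReal |dist p.1 q.1 - dist p.2 q.2|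

/-- The Gromov–Hausdorff distance in `[0, ∞]`. -/
noncomputable def ghEDist (X : Type u) (Y : Type v) [MetricSpace X] [MetricSpace Y] : ℝ≥0∞ :=
  (1 / 2) * ⨅ (R : Set (X × Y)) (_ : IsCorrespondence R), distortion R

theorem ghEDist_self (X : Type u) [MetricSpace X] : ghEDist X X = 0 := by
  have h : IsCorrespondence {p : X × X | p.1 = p.2} := ⟨fun x => ⟨x, rfl⟩, fun x => ⟨x, rfl⟩⟩
  have h0 : distortion {p : X × X | p.1 = p.2} = 0 := by
    simp only [distortion, ENNReal.iSup_eq_zero]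
    rintro ⟨x, x'⟩ hx ⟨y, y'⟩ hy
    obtain rfl : x = x' := hx
    obtain rfl : y = y' := hy
    simp
  have : (⨅ (R : Set (X × X)) (_ : IsCorrespondence R), distortion R) = 0 :=
    le_antisymm ((iInf₂_le _ h).trans h0.le) bot_le
  rw [ghEDist, this, mul_zero]

theorem ghEDist_comm_le (X : Type u) (Y : Type v) [MetricSpace X] [MetricSpace Y] :
    ghEDist X Y ≤ ghEDist Y X := by
  unfold ghEDist
  gcongr
  refine le_iInf₂ fun R hR => (iInf₂_le (Prod.swap ⁻¹' R) ⟨hR.2, hR.1⟩).trans ?_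
  refine iSup₂_le fun p hp => iSup₂_le fun q hq => ?_
  rw [abs_sub_comm]
  exact (le_iSup₂ (f := fun q' (_ : q' ∈ R) =>
    ENNReal.ofReal |dist p.swap.1 q'.1 - dist p.swap.2 q'.2|) q.swap hq).trans
    (le_iSup₂ (f := fun p' (_ : p' ∈ R) => ⨆ q' ∈ R,
      ENNReal.ofReal |dist p'.1 q'.1 - dist p'.2 q'.2|) p.swap hp)

theorem le_distortion {X : Type u} {Y : Type v} [MetricSpace X] [MetricSpace Y]
    {R : Set (X × Y)} {p q : X × Y} (hp : p ∈ R) (hq : q ∈ R) :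
    ENNReal.ofReal |dist p.1 q.1 - dist p.2 q.2| ≤ distortion R :=
  (le_iSup₂ (f := fun q' (_ : q' ∈ R) => ENNReal.ofReal |dist p.1 q'.1 - dist p.2 q'.2|) q hq).trans
    (le_iSup₂ (f := fun p' (_ : p' ∈ R) => ⨆ q' ∈ R,
      ENNReal.ofReal |dist p'.1 q'.1 - dist p'.2 q'.2|) p hp)

theorem ghEDist_triangle (X Y Z : Type u) [MetricSpace X] [MetricSpace Y] [MetricSpace Z] :
    ghEDist X Z ≤ ghEDist X Y + ghEDist Y Z := by
  unfold ghEDist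
  rw [← mul_add]
  gcongr
  simp only [ENNReal.iInf_add, ENNReal.add_iInf]
  refine le_iInf₂ fun R hR => le_iInf₂ fun S hS => ?_
  have hQ : IsCorrespondence {p : X × Z | ∃ y, (p.1, y) ∈ S ∧ (y, p.2) ∈ R} := by
    refine ⟨fun x => ?_, fun z => ?_⟩
    · obtain ⟨y, hy⟩ := hS.1 x
      obtain ⟨z, hz⟩ := hR.1 y
      exact ⟨z, y, hy, hz⟩
    · obtain ⟨y, hy⟩ := hR.2 z
      obtain ⟨x, hx⟩ := hS.2 y
      exact ⟨x, y, hx, hy⟩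
  refine (iInf₂_le _ hQ).trans (iSup₂_le ?_)
  rintro ⟨x, z⟩ ⟨y, hxy, hyz⟩
  refine iSup₂_le ?_
  rintro ⟨x', z'⟩ ⟨y', hxy', hyz'⟩
  refine le_trans ?_ (add_le_add (le_distortion hxy hxy') (le_distortion hyz hyz'))
  rw [← ENNReal.ofReal_add (abs_nonneg _) (abs_nonneg _)]
  exact ENNReal.ofReal_le_ofReal (abs_sub_le _ _ _)

noncomputable instance : PseudoEMetricSpace MetricSp.{u} where
  edist X Y := ghEDist X.carrier Y.carrier
  edist_self X := ghEDist_self X.carrier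
  edist_comm X Y := le_antisymm (ghEDist_comm_le _ _) (ghEDist_comm_le _ _)
  edist_triangle X Y Z := ghEDist_triangle _ _ _

/-- The Gromov–Hausdorff class: non-empty metric spaces, those at zero Gromov–Hausdorff distance
being identified, with the (generalized) metric induced by the Gromov–Hausdorff distance. -/
abbrev GHClass : Type (u + 1) := SeparationQuotient MetricSp.{u}

/-- The element of the Gromov–Hausdorff class given by a non-empty subset of a metric space. -/
noncomputable def GHClass.ofSet {Z : Type u} [MetricSpace Z] (S : Set Z) (h : S.Nonempty) :
    GHClass.{u} :=
  SeparationQuotient.mk (MetricSp.ofSet S h)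

/-- The cloud `[T]`: all elements of the Gromov–Hausdorff class at finite distance from `T`. -/
abbrev Cloud (T : Type u) [MetricSpace T] [Nonempty T] : Type (u + 1) :=
  {c : GHClass.{u} // edist c (SeparationQuotient.mk (MetricSp.mk T)) < ∞}

/-! ### Shortest curves -/

/-- The length of a curve: the supremum over all partitions of the sums of distances between
consecutive points. -/
noncomputable def curveLength {E : Type u} [PseudoEMetricSpace E] {a b : ℝ} (γ : Icc a b → E) :
    ℝ≥0∞ :=
  eVariationOn γ univ

/-- A shortest curve: a continuous curve whose length is the distance between its ends; it is then
no longer than any curve with the same ends. -/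
structure IsShortestCurve {E : Type u} [PseudoEMetricSpace E] {a b : ℝ} (hab : a ≤ b)
    (γ : Icc a b → E) : Prop where
  continuous : Continuous γ
  length_eq : curveLength γ = edist (γ ⟨a, left_mem_Icc.2 hab⟩) (γ ⟨b, right_mem_Icc.2 hab⟩)
  length_le : ∀ {a' b' : ℝ} (hab' : a' ≤ b') (η : Icc a' b' → E), Continuous η →
    η ⟨a', left_mem_Icc.2 hab'⟩ = γ ⟨a, left_mem_Icc.2 hab⟩ →
    η ⟨b', right_mem_Icc.2 hab'⟩ = γ ⟨b, right_mem_Icc.2 hab⟩ →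
    curveLength γ ≤ curveLength η

/-! ### Metric graphs and metric trees -/

/-- The disjoint union of the segments `[l i, r i]`. -/
abbrev SegmentUnion {ι : Type v} (l r : ι → ℝ) : Type v := Σ i, Icc (l i) (r i)

/-- The ends of the segments. -/
def SegmentUnion.IsEnd {ι : Type v} {l r : ι → ℝ} (p : SegmentUnion l r) : Prop :=
  (p.2 : ℝ) = l p.1 ∨ (p.2 : ℝ) = r p.1

/-- `SegmentPath π x y L`: after the gluing `π` of the segments, one can go from `x` to `y` by
finitely many moves, each inside a single segment, of total length `L`. -/
inductive SegmentPath {T : Type u} {ι : Type v} {l r : ι → ℝ} (π : SegmentUnion l r → T) :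
    T → T → ℝ → Prop
  | nil (x : T) : SegmentPath π x x 0
  | cons (i : ι) (s t : Icc (l i) (r i)) (y : T) (L : ℝ) :
      SegmentPath π (π ⟨i, t⟩) y L → SegmentPath π (π ⟨i, s⟩) y (|(s : ℝ) - t| + L)

/-- A presentation of the metric space `T` as a metric graph: as a set, `T` is the quotient (by the
map `proj`) of a disjoint union of non-degenerate segments by an equivalence relation which
identifies some of their ends, and its distance is the intrinsic one, that is, the infimum of the
lengths of paths composed of pieces of segments. (The infimum is taken in `ℝ`, so each two points
are joined by such a path.) -/
structure MetricGraph (T : Type u) [MetricSpace T] where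
  /-- the index set of the segments -/
  ι : Type v
  l : ι → ℝ
  r : ι → ℝ
  l_lt_r : ∀ i, l i < r i
  proj : SegmentUnion l r → T
  proj_surjective : Function.Surjective proj
  proj_eq : ∀ p q, proj p = proj q → p = q ∨ (p.IsEnd ∧ q.IsEnd)
  isGLB_dist : ∀ x y, IsGLB {L | SegmentPath proj x y L} (dist x y)

namespace MetricGraph

variable {T : Type u} [MetricSpace T] (G : MetricGraph.{u, v} T)

/-- The first end in `T` of the `i`-th edge. -/
def leftEnd (i : G.ι) : T := G.proj ⟨i, ⟨G.l i, left_mem_Icc.2 (G.l_lt_r i).le⟩⟩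

/-- The second end in `T` of the `i`-th edge. -/
def rightEnd (i : G.ι) : T := G.proj ⟨i, ⟨G.r i, right_mem_Icc.2 (G.l_lt_r i).le⟩⟩

/-- The vertices: the images of the ends of the segments. -/
def vertices : Set T := {x | ∃ i, x = G.leftEnd i ∨ x = G.rightEnd i}

/-- The degree of a vertex: the number of ends of segments glued to it. -/
noncomputable def degree (x : T) : ℕ∞ :=
  Set.encard {p : SegmentUnion G.l G.r | p.IsEnd ∧ G.proj p = x}

/-- Adjacency of distinct vertices. -/
def toSimpleGraph : SimpleGraph G.vertices where
  Adj x y := x ≠ y ∧ ∃ i, s((x : T), (y : T)) = s(G.leftEnd i, G.rightEnd i)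
  symm := ⟨fun _ _ h => ⟨h.1.symm, h.2.imp fun _ hi => Sym2.eq_swap.trans hi⟩⟩
  loopless := ⟨fun _ h => h.1 rfl⟩

/-- The graph is a tree: connected and without cycles. Cycles of length one (loops) and two
(two edges with the same ends) are excluded separately, longer ones by `toSimpleGraph.IsTree`. -/
structure IsTree : Prop where
  no_loop : ∀ i, G.leftEnd i ≠ G.rightEnd i
  no_parallel : ∀ i j,
    s(G.leftEnd i, G.rightEnd i) = s(G.leftEnd j, G.rightEnd j) → i = j
  isTree : G.toSimpleGraph.IsTree

end MetricGraph

/-! ### Internal points and end points with respect to a subset -/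

/-- `Int_X T`: the points outside `X` lying on an embedded segment with both ends in `X`. -/
def relInterior {T : Type u} [MetricSpace T] (X : Set T) : Set T :=
  {a | a ∉ X ∧ ∃ γ : unitInterval → T, Topology.IsEmbedding γ ∧ γ 0 ∈ X ∧ γ 1 ∈ X ∧
    a ∈ range γ}

/-- `∂_X T`: the remaining points outside `X`. -/
def relBoundary {T : Type u} [MetricSpace T] (X : Set T) : Set T :=
  Xᶜ \ relInterior X

/-! ### Metric graphs as length spaces -/

namespace MetricGraph

variable {T : Type u} [MetricSpace T] (G : MetricGraph.{u, v} T)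

/-! Everything follows from `d ≤ d_GH(X, T) ≤ length ≤ d`, where `d = d_H(X, T)`; the middle
inequality holds for every curve. Upper bound: since `B_{d-t}(T) = T`, the curve is `C_t = B_t(X)`.
Distances in `T` are infima of path lengths, so each point of `B_t(X)` is almost within `t - s` of
`B_s(X)`; hence the curve is 1-Lipschitz (`ghEDist_cthickening_le`) and its length is at most `d`.
Lower bound (`hausdorffEDist_le_ghEDist`): a point `a` of `Int_X T` is a cut point splitting `X`
into non-empty `A`, `B` with `|pa| + |aq| ≤ |pq|` across the cut, so `A` and `B` are at least
`2|aX|` apart. A correspondence sends them to two sets covering the connected space `T`, and these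
contain arbitrarily close points; its distortion is therefore at least `2|aX|`, and `|aX| ≤ d_GH(X,
T)`. The points of `∂_X T` stay strictly below the supremum `d`, so the internal points alone
determine it. Cut points are handled through the 1-Lipschitz retraction `coord e` of the tree onto
an edge `e`. -/

theorem dist_le_of_segmentPath {x y : T} {L : ℝ} (h : SegmentPath G.proj x y L) :
    dist x y ≤ L :=
  (G.isGLB_dist x y).1 h

theorem dist_proj_le (i : G.ι) (s t : Icc (G.l i) (G.r i)) :
    dist (G.proj ⟨i, s⟩) (G.proj ⟨i, t⟩) ≤ |(s : ℝ) - t| := by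
  simpa using G.dist_le_of_segmentPath (.cons i s t _ 0 (.nil _))

theorem exists_segmentPath_lt (x y : T) {c : ℝ} (h : dist x y < c) :
    ∃ L, SegmentPath G.proj x y L ∧ L < c := by
  by_contra! H
  exact absurd ((G.isGLB_dist x y).2 fun L hL => H L hL) (not_le.2 h)

/-- Cut the path at length `m`: whole moves are used up until the cut falls inside a single segment,
which is then divided. -/
theorem exists_dist_le_of_segmentPath {x y : T} {L : ℝ} (h : SegmentPath G.proj x y L) {m : ℝ}
    (h0 : 0 ≤ m) (hm : m ≤ L) : ∃ z, dist x z ≤ m ∧ dist z y ≤ L - m := by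
  induction h generalizing m with
  | nil x => exact ⟨x, by simpa, by simpa using hm⟩
  | cons i s t y L h ih =>
    rcases le_total m |(s : ℝ) - t| with hc | hc
    · have hy := G.dist_le_of_segmentPath h
      obtain ⟨u, hu, hu'⟩ : ∃ u : Icc (G.l i) (G.r i),
          |(s : ℝ) - u| ≤ m ∧ |(u : ℝ) - t| ≤ |(s : ℝ) - t| - m := by
        have hs := s.2
        have ht := t.2
        rcases le_total (s : ℝ) t with hst | hst
        · rw [abs_of_nonpos (sub_nonpos.2 hst)] at hc ⊢
          refine ⟨⟨s + m, by linarith [hs.1], by linarith [ht.2]⟩, ?_, ?_⟩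
          · exact abs_le.2 ⟨by simp, by simp; linarith⟩
          · exact abs_le.2 ⟨by simp, by simp; linarith⟩
        · rw [abs_of_nonneg (sub_nonneg.2 hst)] at hc ⊢
          refine ⟨⟨s - m, by linarith [ht.1], by linarith [hs.2]⟩, ?_, ?_⟩
          · exact abs_le.2 ⟨by simp; linarith, by simp⟩
          · exact abs_le.2 ⟨by simp; linarith, by simp; linarith⟩
      refine ⟨G.proj ⟨i, u⟩, (G.dist_proj_le i s u).trans hu, ?_⟩
      linarith [dist_triangle (G.proj ⟨i, u⟩) (G.proj ⟨i, t⟩) y, G.dist_proj_le i u t]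
    · obtain ⟨z, hz, hz'⟩ := ih (m := m - |(s : ℝ) - t|) (by linarith) (by linarith)
      refine ⟨z, ?_, by linarith⟩
      linarith [dist_triangle (G.proj ⟨i, s⟩) (G.proj ⟨i, t⟩) z, G.dist_proj_le i s t]

theorem exists_dist_lt_dist_lt (G : MetricGraph.{u, v} T) (x y : T) {a b : ℝ}
    (ha : 0 < a) (hb : 0 < b) (h : dist x y < a + b) : ∃ z, dist x z < a ∧ dist z y < b := by
  obtain ⟨L, hL, hlt⟩ := G.exists_segmentPath_lt x y h
  have hL0 : 0 ≤ L := dist_nonneg.trans (G.dist_le_of_segmentPath hL)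
  -- Dividing a path of length `L < a + b` in the ratio `a : b` makes both pieces strictly short
  -- enough.
  obtain ⟨z, hz, hz'⟩ := G.exists_dist_le_of_segmentPath hL (m := L * (a / (a + b)))
    (by positivity) (mul_le_of_le_one_right hL0 ((div_le_one (by positivity)).2 (by linarith)))
  have key : ∀ c : ℝ, 0 < c → L * (c / (a + b)) < c := fun c hc => by
    rw [mul_div_assoc', div_lt_iff₀ (by positivity), mul_comm]
    exact mul_lt_mul_of_pos_left hlt hc
  refine ⟨z, hz.trans_lt (key a ha), hz'.trans_lt ?_⟩
  have : L - L * (a / (a + b)) = L * (b / (a + b)) := by field_simp; ring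
  rw [this]
  exact key b hb

theorem continuous_proj_mk (i : G.ι) :
    Continuous fun s : Icc (G.l i) (G.r i) => G.proj ⟨i, s⟩ :=
  (LipschitzWith.of_dist_le_mul (K := 1) fun s t => by
    simpa [Subtype.dist_eq, Real.dist_eq] using G.dist_proj_le i s t).continuous

theorem exists_isPreconnected {x y : T} {L : ℝ} (h : SegmentPath G.proj x y L) :
    ∃ S : Set T, x ∈ S ∧ y ∈ S ∧ IsPreconnected S := by
  induction h with
  | nil x => exact ⟨{x}, rfl, rfl, isPreconnected_singleton⟩
  | cons i s t y L h ih =>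
    obtain ⟨S, h1, h2, h3⟩ := ih
    have : PreconnectedSpace (Icc (G.l i) (G.r i)) :=
      Subtype.preconnectedSpace isPreconnected_Icc
    exact ⟨(range fun s : Icc (G.l i) (G.r i) => G.proj ⟨i, s⟩) ∪ S, Or.inl ⟨s, rfl⟩, Or.inr h2,
      (isPreconnected_range (G.continuous_proj_mk i)).union _ ⟨t, rfl⟩ h1 h3⟩

theorem preconnectedSpace (G : MetricGraph.{u, v} T) : PreconnectedSpace T := by
  rcases isEmpty_or_nonempty T with h | ⟨⟨x⟩⟩
  · exact ⟨Subsingleton.isPreconnected (fun x => (h.false x).elim)⟩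
  · refine ⟨isPreconnected_of_forall x fun y _ => ?_⟩
    obtain ⟨L, hL, -⟩ := G.exists_segmentPath_lt x y (lt_add_one _)
    obtain ⟨S, h1, h2, h3⟩ := G.exists_isPreconnected hL
    exact ⟨S, subset_univ _, h1, h2, h3⟩

/-! ### The retraction of a metric tree onto an edge -/

/-- The first end of an edge, as a vertex. -/
def leftVertex (i : G.ι) : G.vertices := ⟨G.leftEnd i, i, Or.inl rfl⟩

/-- The second end of an edge, as a vertex. -/
def rightVertex (i : G.ι) : G.vertices := ⟨G.rightEnd i, i, Or.inr rfl⟩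

open Classical in
/-- The coordinate of the end of the edge `e` which a vertex is connected with outside `e`. -/
noncomputable def vertexCoord (e : G.ι) (x : G.vertices) : ℝ :=
  if (G.toSimpleGraph.deleteEdges {s(G.leftVertex e, G.rightVertex e)}).Reachable
    (G.leftVertex e) x then G.l e else G.r e

open Classical in
/-- The coordinate of the retraction onto the edge `e`, on the disjoint union of the segments. -/
noncomputable def segmentCoord (e : G.ι) (p : SegmentUnion G.l G.r) : ℝ :=
  if p.1 = e then p.2 else G.vertexCoord e (G.leftVertex p.1)

/-- The coordinate of the retraction of a metric tree onto the edge `e`. -/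
noncomputable def coord (e : G.ι) (x : T) : ℝ :=
  G.segmentCoord e (Function.surjInv G.proj_surjective x)

theorem vertexCoord_mem (e : G.ι) (x : G.vertices) : G.vertexCoord e x ∈ Icc (G.l e) (G.r e) := by
  unfold vertexCoord
  have := (G.l_lt_r e).le
  split_ifs
  · exact ⟨le_rfl, this⟩
  · exact ⟨this, le_rfl⟩

theorem vertexCoord_ne (e : G.ι) (x : G.vertices) {c : ℝ} (hl : G.l e < c) (hr : c < G.r e) :
    G.vertexCoord e x ≠ c := by
  unfold vertexCoord
  split_ifs
  · exact hl.ne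
  · exact hr.ne'

theorem vertexCoord_leftVertex (e : G.ι) : G.vertexCoord e (G.leftVertex e) = G.l e :=
  if_pos (SimpleGraph.Reachable.refl _)

variable {G}

theorem IsTree.adj (hG : G.IsTree) (e : G.ι) :
    G.toSimpleGraph.Adj (G.leftVertex e) (G.rightVertex e) :=
  ⟨fun h => hG.no_loop e (congrArg Subtype.val h), e, rfl⟩

/-- An edge of an acyclic graph is a bridge, so deleting it disconnects its two ends. -/
theorem IsTree.vertexCoord_rightVertex (hG : G.IsTree) (e : G.ι) :
    G.vertexCoord e (G.rightVertex e) = G.r e := by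
  have := SimpleGraph.isAcyclic_iff_forall_adj_isBridge.1 hG.isTree.isAcyclic (hG.adj e)
  exact if_neg (SimpleGraph.isBridge_iff.1 this)

theorem IsTree.sym2_ne (hG : G.IsTree) {e i : G.ι} (h : i ≠ e) :
    s(G.leftVertex i, G.rightVertex i) ≠ s(G.leftVertex e, G.rightVertex e) := fun he =>
  h (hG.no_parallel i e
    (by simpa [leftVertex, rightVertex] using congrArg (Sym2.map Subtype.val) he))

theorem IsTree.vertexCoord_eq (hG : G.IsTree) {e i : G.ι} (h : i ≠ e) :
    G.vertexCoord e (G.leftVertex i) = G.vertexCoord e (G.rightVertex i) := by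
  have hadj : (G.toSimpleGraph.deleteEdges {s(G.leftVertex e, G.rightVertex e)}).Adj
      (G.leftVertex i) (G.rightVertex i) := by
    rw [SimpleGraph.deleteEdges_adj]
    exact ⟨hG.adj i, hG.sym2_ne h⟩
  unfold vertexCoord
  congr 1
  exact propext ⟨fun H => H.trans hadj.reachable, fun H => H.trans hadj.symm.reachable⟩

theorem IsTree.segmentCoord_of_isEnd (hG : G.IsTree) (e : G.ι) (p : SegmentUnion G.l G.r)
    (hp : p.IsEnd) (x : G.vertices) (hx : G.proj p = x) :
    G.segmentCoord e p = G.vertexCoord e x := by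
  obtain ⟨i, s, hs⟩ := p
  obtain ⟨x, hxv⟩ := x
  obtain rfl : G.proj ⟨i, s, hs⟩ = x := hx
  rcases hp with hp | hp <;> dsimp only at hp <;> subst hp
  · change G.segmentCoord e _ = G.vertexCoord e (G.leftVertex i)
    unfold segmentCoord
    split_ifs with h
    · obtain rfl : i = e := h
      exact (G.vertexCoord_leftVertex i).symm
    · rfl
  · change G.segmentCoord e _ = G.vertexCoord e (G.rightVertex i)
    unfold segmentCoord
    split_ifs with h
    · obtain rfl : i = e := h
      exact (hG.vertexCoord_rightVertex i).symm
    · exact hG.vertexCoord_eq h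

theorem proj_mem_vertices {p : SegmentUnion G.l G.r} (hp : p.IsEnd) : G.proj p ∈ G.vertices := by
  obtain ⟨i, s, hs⟩ := p
  rcases hp with hp | hp <;> dsimp only at hp <;> subst hp
  · exact ⟨i, Or.inl rfl⟩
  · exact ⟨i, Or.inr rfl⟩

/-- The coordinate does not depend on the preimage chosen by `surjInv`: distinct preimages of one
point are ends of segments, where the value depends on the vertex only. -/
theorem IsTree.coord_proj (hG : G.IsTree) (e : G.ι) (p : SegmentUnion G.l G.r) :
    G.coord e (G.proj p) = G.segmentCoord e p := by
  have h := Function.surjInv_eq G.proj_surjective (G.proj p)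
  unfold coord
  rcases G.proj_eq _ _ h with h' | ⟨h1, h2⟩
  · rw [h']
  · rw [hG.segmentCoord_of_isEnd e _ h1 ⟨_, proj_mem_vertices h2⟩ h,
      hG.segmentCoord_of_isEnd e _ h2 ⟨_, proj_mem_vertices h2⟩ rfl]

theorem IsTree.coord_self (hG : G.IsTree) (e : G.ι) (s : Icc (G.l e) (G.r e)) :
    G.coord e (G.proj ⟨e, s⟩) = s := by
  rw [hG.coord_proj]; exact if_pos rfl

theorem IsTree.coord_of_ne (hG : G.IsTree) {e i : G.ι} (h : i ≠ e) (s : Icc (G.l i) (G.r i)) :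
    G.coord e (G.proj ⟨i, s⟩) = G.vertexCoord e (G.leftVertex i) := by
  rw [hG.coord_proj]; exact if_neg h

theorem IsTree.coord_mem (hG : G.IsTree) (e : G.ι) (x : T) :
    G.coord e x ∈ Icc (G.l e) (G.r e) := by
  obtain ⟨⟨i, s⟩, rfl⟩ := G.proj_surjective x
  by_cases h : i = e
  · subst h
    rw [hG.coord_self]
    exact s.2
  · rw [hG.coord_of_ne h]
    exact G.vertexCoord_mem e _

/-- Everything outside `e` is sent to one of the two extreme values, so the fibres over interior
values are single points. -/
theorem IsTree.eq_proj_of_coord_eq (hG : G.IsTree) (e : G.ι) (x : T)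
    (c : Icc (G.l e) (G.r e)) (hl : G.l e < c) (hr : (c : ℝ) < G.r e) (h : G.coord e x = c) :
    x = G.proj ⟨e, c⟩ := by
  obtain ⟨⟨i, s⟩, rfl⟩ := G.proj_surjective x
  by_cases hi : i = e
  · subst hi
    rw [hG.coord_self] at h
    rw [Subtype.ext h]
  · rw [hG.coord_of_ne hi] at h
    exact absurd h (G.vertexCoord_ne e _ hl hr)

theorem IsTree.abs_coord_sub_le (hG : G.IsTree) (e : G.ι) {x y : T} {L : ℝ}
    (h : SegmentPath G.proj x y L) : |G.coord e x - G.coord e y| ≤ L := by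
  induction h with
  | nil x => simp
  | cons i s t y L h ih =>
    have : |G.coord e (G.proj ⟨i, s⟩) - G.coord e (G.proj ⟨i, t⟩)| ≤ |(s : ℝ) - t| := by
      by_cases hi : i = e
      · subst hi
        rw [hG.coord_self, hG.coord_self]
      · rw [hG.coord_of_ne hi, hG.coord_of_ne hi, sub_self, abs_zero]
        exact abs_nonneg _
    exact (abs_sub_le _ _ _).trans (add_le_add this ih)

theorem IsTree.continuous_coord (hG : G.IsTree) (e : G.ι) : Continuous (G.coord e) :=
  (LipschitzWith.of_dist_le_mul (K := 1) fun x y => by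
    rw [Real.dist_eq, NNReal.coe_one, one_mul]
    exact (G.isGLB_dist x y).2 fun L hL => hG.abs_coord_sub_le e hL).continuous

/-- Moves outside `e` leave the coordinate unchanged, so every path from `p` to `q` must pass the
point `c` during a move inside `e`. The strict inequality matters when `c` is an end of `e`:
otherwise `p` and `q` could lie in the same branch. -/
theorem IsTree.dist_add_dist_le (hG : G.IsTree) (e : G.ι) (c : Icc (G.l e) (G.r e)) {p q : T}
    (hp : G.coord e p ≤ c) (hq : c ≤ G.coord e q) (hpq : G.coord e p < G.coord e q) :
    dist p (G.proj ⟨e, c⟩) + dist (G.proj ⟨e, c⟩) q ≤ dist p q := by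
  refine (G.isGLB_dist p q).2 fun L hL => ?_
  induction hL with
  | nil x => exact absurd hpq (lt_irrefl _)
  | cons i s t y L h ih =>
    have hst := G.dist_proj_le i s t
    by_cases hi : i = e
    · subst hi
      rw [hG.coord_self] at hp hpq ih
      rcases lt_or_ge (t : ℝ) c with ht | ht
      · have := ih ht.le hq (ht.trans_le hq)
        linarith [dist_triangle (G.proj ⟨i, s⟩) (G.proj ⟨i, t⟩) (G.proj ⟨i, c⟩)]
      · have h1 := G.dist_proj_le i s c
        have h2 := G.dist_proj_le i c t
        have h3 := G.dist_le_of_segmentPath h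
        have h4 := dist_triangle (G.proj ⟨i, c⟩) (G.proj ⟨i, t⟩) y
        have h5 : |(s : ℝ) - c| + |(c : ℝ) - t| = |(s : ℝ) - t| := by
          rw [abs_of_nonpos (sub_nonpos.2 hp), abs_of_nonpos (sub_nonpos.2 ht),
            abs_of_nonpos (sub_nonpos.2 (hp.trans ht))]
          ring
        linarith
    · rw [hG.coord_of_ne hi] at hp hpq ih
      have := ih hp hq hpq
      linarith [dist_triangle (G.proj ⟨i, s⟩) (G.proj ⟨i, t⟩) (G.proj ⟨e, c⟩)]

/-! ### Cut points and separation of `X` by internal points -/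

theorem vertexCoord_eq_of_walk (e : G.ι) {x y : G.vertices}
    (w : G.toSimpleGraph.Walk x y) (hw : s(G.leftVertex e, G.rightVertex e) ∉ w.edges) :
    G.vertexCoord e x = G.vertexCoord e y := by
  have hxy := w.toDeleteEdge _ hw
  unfold vertexCoord
  congr 1
  exact propext ⟨fun H => H.trans ⟨hxy⟩, fun H => H.trans ⟨hxy.reverse⟩⟩

/-- The edge `e` is the one on which the way from `a` to `z` begins. -/
theorem IsTree.exists_coord_ne (hG : G.IsTree) {a z : T} (h : z ≠ a) :
    ∃ (e : G.ι) (c : Icc (G.l e) (G.r e)), G.proj ⟨e, c⟩ = a ∧ G.coord e z ≠ c := by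
  by_cases ha : a ∈ G.vertices
  · obtain ⟨⟨j, t⟩, rfl⟩ := G.proj_surjective z
    by_cases hj : ∃ c : Icc (G.l j) (G.r j), G.proj ⟨j, c⟩ = a
    · obtain ⟨c, rfl⟩ := hj
      refine ⟨j, c, rfl, fun hc => h ?_⟩
      rw [hG.coord_self] at hc
      rw [Subtype.ext hc]
    · obtain ⟨w, hw⟩ := hG.isTree.connected.exists_isPath ⟨a, ha⟩ (G.leftVertex j)
      cases w with
      | nil => exact absurd ⟨_, rfl⟩ hj
      | @cons _ b _ hadj w =>
        obtain ⟨e, he⟩ := hadj.2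
        have hev : s(⟨a, ha⟩, b) = s(G.leftVertex e, G.rightVertex e) :=
          Sym2.map.injective Subtype.val_injective (by simpa [leftVertex, rightVertex] using he)
        rw [SimpleGraph.Walk.cons_isPath_iff] at hw
        -- The rest of the simple path never returns to `a`, hence avoids `e`; so `z` lies on the
        -- side of the far end `b`.
        have hb : G.vertexCoord e b = G.vertexCoord e (G.leftVertex j) := by
          refine vertexCoord_eq_of_walk e w fun hmem => hw.2 ?_
          rw [← hev] at hmem
          exact w.fst_mem_support_of_mem_edges hmem
        have key : ∀ c : Icc (G.l e) (G.r e), G.proj ⟨e, c⟩ = a →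
            G.coord e (G.proj ⟨j, t⟩) = G.vertexCoord e b := fun c hc => by
          rw [hG.coord_of_ne (fun hje => hj (by subst hje; exact ⟨c, hc⟩)), hb]
        have hlr := G.l_lt_r e
        rw [Sym2.eq_iff] at hev
        rcases hev with ⟨h1, h2⟩ | ⟨h1, h2⟩
        · have h1' : G.proj ⟨e, _⟩ = a := (congrArg Subtype.val h1).symm
          refine ⟨e, _, h1', ?_⟩
          rw [key _ h1', h2, hG.vertexCoord_rightVertex]
          exact hlr.ne'
        · have h1' : G.proj ⟨e, _⟩ = a := (congrArg Subtype.val h1).symm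
          refine ⟨e, _, h1', ?_⟩
          rw [key _ h1', h2, G.vertexCoord_leftVertex]
          exact hlr.ne
  · obtain ⟨⟨i, s⟩, rfl⟩ := G.proj_surjective a
    refine ⟨i, s, rfl, fun hs => h ?_⟩
    refine hG.eq_proj_of_coord_eq i z s ?_ ?_ hs
    · exact lt_of_le_of_ne s.2.1 fun hl => ha (proj_mem_vertices (Or.inl hl.symm))
    · exact lt_of_le_of_ne s.2.2 fun hr => ha (proj_mem_vertices (Or.inr hr))

/-- Every point `a` of a metric tree is a cut point: a branch at `a` is given by a continuous
function which is injective between `a` and a chosen point of the branch. -/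
theorem IsTree.exists_separating (hG : G.IsTree) {a z : T} (h : z ≠ a) :
    ∃ φ : T → ℝ, Continuous φ ∧ φ z < φ a ∧
      (∀ x y, φ z < φ x → φ x < φ a → φ x = φ y → x = y) ∧
      ∀ p q, φ p < φ a → φ a ≤ φ q → dist p a + dist a q ≤ dist p q := by
  obtain ⟨e, c, rfl, hc⟩ := hG.exists_coord_ne h
  have hz := hG.coord_mem e z
  have huniq : ∀ x y, G.l e < G.coord e x → G.coord e x < G.r e → G.coord e x = G.coord e y →
      x = y := fun x y h1 h2 hxy =>
    (hG.eq_proj_of_coord_eq e x ⟨_, h1.le, h2.le⟩ h1 h2 rfl).trans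
      (hG.eq_proj_of_coord_eq e y ⟨_, h1.le, h2.le⟩ h1 h2 hxy.symm).symm
  rcases lt_or_gt_of_ne hc with hc | hc
  · refine ⟨G.coord e, hG.continuous_coord e, by rwa [hG.coord_self], ?_, ?_⟩
    · rw [hG.coord_self]
      exact fun x y h1 h2 => huniq x y (hz.1.trans_lt h1) (h2.trans_le c.2.2)
    · rw [hG.coord_self]
      exact fun p q hp hq => hG.dist_add_dist_le e c hp.le hq (hp.trans_le hq)
  · refine ⟨fun x => -G.coord e x, (hG.continuous_coord e).neg, ?_, ?_, ?_⟩
    · simpa [hG.coord_self] using hc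
    · simp only [neg_lt_neg_iff, neg_inj]
      rw [hG.coord_self]
      exact fun x y h1 h2 => huniq x y (c.2.1.trans_lt h2) (h1.trans_le hz.2)
    · simp only [neg_lt_neg_iff, neg_le_neg_iff]
      rw [hG.coord_self]
      intro p q hp hq
      have := hG.dist_add_dist_le e c hq hp.le (hq.trans_lt hp)
      rwa [dist_comm q, dist_comm _ p, dist_comm q, add_comm] at this

theorem IsTree.exists_separating_of_mem_relInterior (hG : G.IsTree) {X : Set T} {a : T}
    (ha : a ∈ relInterior X) :
    ∃ A B : Set T, A ∪ B = X ∧ A.Nonempty ∧ B.Nonempty ∧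
      ∀ p ∈ A, ∀ q ∈ B, dist p a + dist a q ≤ dist p q := by
  obtain ⟨haX, γ, hγ, h0, h1, s, rfl⟩ := ha
  obtain ⟨φ, hφ, hlt, hinj, hsep⟩ :=
    hG.exists_separating (a := γ s) (z := γ 0) fun h => haX (h ▸ h0)
  -- Were `γ 1` in the same branch as `γ 0`, some value `m` just below `φ (γ s)` would be taken both
  -- before and after `s`; it has a one-point fibre, contradicting injectivity of `γ`.
  have hle : φ (γ s) ≤ φ (γ 1) := by
    by_contra! hlt'
    obtain ⟨m, hm, hm'⟩ := exists_between (max_lt hlt hlt')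
    have hcont : Continuous (φ ∘ γ) := hφ.comp hγ.continuous
    obtain ⟨u, hu, hum⟩ := intermediate_value_Icc (unitInterval.nonneg' (t := s))
      hcont.continuousOn ⟨((le_max_left _ _).trans_lt hm).le, hm'.le⟩
    obtain ⟨w, hw, hwm⟩ := intermediate_value_Icc' (unitInterval.le_one' (t := s))
      hcont.continuousOn ⟨((le_max_right _ _).trans_lt hm).le, hm'.le⟩
    simp only [Function.comp_apply] at hum hwm
    have huw : u = w := hγ.injective (hinj _ _ (hum ▸ (le_max_left _ _).trans_lt hm) (hum ▸ hm')
      (hum.trans hwm.symm))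
    have hus : u = s := le_antisymm hu.2 (huw ▸ hw.1)
    rw [hus] at hum
    exact hm'.ne hum.symm
  refine ⟨{p ∈ X | φ p < φ (γ s)}, {p ∈ X | φ (γ s) ≤ φ p}, ?_, ⟨γ 0, h0, hlt⟩, ⟨γ 1, h1, hle⟩,
    fun p hp q hq => hsep p q hp.2 hq.2⟩
  ext p
  simp only [mem_union, mem_ofPred_eq, ← and_or_left, and_iff_left_iff_imp]
  exact fun _ => lt_or_ge _ _

end MetricGraph

/-! ### Estimates of the Gromov–Hausdorff distance -/

/-- The open `δ/2`-neighbourhoods of `P` and `Q` cover a connected space, so they meet. -/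
theorem exists_dist_lt_of_union_eq_univ {T : Type u} [MetricSpace T] [PreconnectedSpace T]
    {P Q : Set T} (hPQ : P ∪ Q = univ) (hP : P.Nonempty) (hQ : Q.Nonempty) {δ : ℝ} (hδ : 0 < δ) :
    ∃ p ∈ P, ∃ q ∈ Q, dist p q < δ := by
  have hδ2 := half_pos hδ
  obtain ⟨z, -, hzP, hzQ⟩ := isPreconnected_univ (thickening (δ / 2) P) (thickening (δ / 2) Q)
    isOpen_thickening isOpen_thickening
    (hPQ ▸ union_subset_union (self_subset_thickening hδ2 P) (self_subset_thickening hδ2 Q))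
    (by simpa using hP.mono (self_subset_thickening hδ2 P))
    (by simpa using hQ.mono (self_subset_thickening hδ2 Q))
  obtain ⟨p, hp, hzp⟩ := mem_thickening_iff.1 hzP
  obtain ⟨q, hq, hzq⟩ := mem_thickening_iff.1 hzQ
  exact ⟨p, hp, q, hq, by linarith [dist_triangle_left p q z]⟩

theorem ofReal_le_distortion {S : Type u} {T : Type u} [MetricSpace S] [MetricSpace T]
    [PreconnectedSpace T] {A B : Set S} (hAB : A ∪ B = univ) (hA : A.Nonempty) (hB : B.Nonempty)
    {r : ℝ} (hr : ∀ p ∈ A, ∀ q ∈ B, r ≤ dist p q) {R : Set (S × T)} (hR : IsCorrespondence R) :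
    ENNReal.ofReal r ≤ distortion R := by
  refine ENNReal.le_of_forall_pos_le_add fun ε hε _ => ?_
  obtain ⟨p, ⟨x, hx, hxp⟩, q, ⟨y, hy, hyq⟩, hpq⟩ := exists_dist_lt_of_union_eq_univ
    (P := {p | ∃ x ∈ A, (x, p) ∈ R}) (Q := {q | ∃ y ∈ B, (y, q) ∈ R})
    (by
      refine eq_univ_of_forall fun t => ?_
      obtain ⟨x, hx⟩ := hR.2 t
      rcases hAB.ge (mem_univ x) with h | h
      · exact Or.inl ⟨x, h, hx⟩
      · exact Or.inr ⟨x, h, hx⟩)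
    (by obtain ⟨x, hx⟩ := hA; obtain ⟨t, ht⟩ := hR.1 x; exact ⟨t, x, hx, ht⟩)
    (by obtain ⟨x, hx⟩ := hB; obtain ⟨t, ht⟩ := hR.1 x; exact ⟨t, x, hx, ht⟩)
    (NNReal.coe_pos.2 hε)
  rw [← tsub_le_iff_right, ← ENNReal.ofReal_coe_nnreal, ← ENNReal.ofReal_sub _ ε.coe_nonneg]
  refine le_trans (ENNReal.ofReal_le_ofReal ?_) (le_distortion hxp hyq)
  exact le_trans (by linarith [hr x hx y hy]) (le_abs_self _)

/-- Pairing points at distance at most `r` gives distortion at most `2r`, which the factor `1/2`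
turns into `r`. -/
theorem ghEDist_le_of_forall_exists_dist_le {Z : Type u} [MetricSpace Z] {S S' : Set Z} {r : ℝ}
    (h : ∀ x ∈ S, ∃ y ∈ S', dist x y ≤ r) (h' : ∀ y ∈ S', ∃ x ∈ S, dist x y ≤ r) :
    ghEDist S S' ≤ ENNReal.ofReal r := by
  have hR : IsCorrespondence {p : S × S' | dist (p.1 : Z) p.2 ≤ r} :=
    ⟨fun x => let ⟨y, hy, hxy⟩ := h x x.2; ⟨⟨y, hy⟩, hxy⟩,
      fun y => let ⟨x, hx, hxy⟩ := h' y y.2; ⟨⟨x, hx⟩, hxy⟩⟩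
  have hdis : distortion {p : S × S' | dist (p.1 : Z) p.2 ≤ r} ≤ 2 * ENNReal.ofReal r := by
    refine iSup₂_le fun p hp => iSup₂_le fun q hq => ?_
    simp only [mem_ofPred_eq] at hp hq
    rw [two_mul, ← ENNReal.ofReal_add (dist_nonneg.trans hp) (dist_nonneg.trans hp)]
    refine ENNReal.ofReal_le_ofReal ?_
    rw [Subtype.dist_eq, Subtype.dist_eq]
    have := dist_dist_dist_le (p.1 : Z) q.1 p.2 q.2
    rw [Real.dist_eq] at this
    linarith
  calc ghEDist S S' ≤ 1 / 2 * (2 * ENNReal.ofReal r) := by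
        unfold ghEDist
        gcongr
        exact (iInf₂_le _ hR).trans hdis
    _ = ENNReal.ofReal r := by
        rw [← mul_assoc, one_div, ENNReal.inv_mul_cancel two_ne_zero ENNReal.ofNat_ne_top, one_mul]

theorem ghEDist_univ (T : Type u) [MetricSpace T] : ghEDist (univ : Set T) T = 0 := by
  have h : IsCorrespondence {p : ↥(univ : Set T) × T | (p.1 : T) = p.2} :=
    ⟨fun x => ⟨x, rfl⟩, fun x => ⟨⟨x, mem_univ x⟩, rfl⟩⟩
  have h0 : distortion {p : ↥(univ : Set T) × T | (p.1 : T) = p.2} = 0 := by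
    simp only [distortion, ENNReal.iSup_eq_zero]
    rintro ⟨x, x'⟩ hx ⟨y, y'⟩ hy
    obtain rfl : (x : T) = x' := hx
    obtain rfl : (y : T) = y' := hy
    simp [Subtype.dist_eq]
  have : (⨅ (R : Set (↥(univ : Set T) × T)) (_ : IsCorrespondence R), distortion R) = 0 :=
    le_antisymm ((iInf₂_le _ h).trans h0.le) bot_le
  rw [ghEDist, this, mul_zero]

theorem MetricGraph.IsTree.infEDist_le_ghEDist {T : Type u} [MetricSpace T]
    {G : MetricGraph.{u, v} T} (hG : G.IsTree) {X : Set T} {a : T} (ha : a ∈ relInterior X) :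
    infEDist a X ≤ ghEDist X T := by
  obtain ⟨A, B, hAB, hA, hB, hsep⟩ := hG.exists_separating_of_mem_relInterior ha
  have := G.preconnectedSpace
  have hAX : A ⊆ X := hAB ▸ subset_union_left
  have hBX : B ⊆ X := hAB ▸ subset_union_right
  have hne : X.Nonempty := hA.mono hAX
  have key : 2 * infEDist a X ≤
      ⨅ (R : Set (X × T)) (_ : IsCorrespondence R), distortion R := by
    refine le_iInf₂ fun R hR => ?_
    have : 2 * infEDist a X = ENNReal.ofReal (2 * infDist a X) := by
      rw [infDist, ENNReal.ofReal_mul zero_le_two, ENNReal.ofReal_toReal (infEDist_ne_top hne)]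
      simp
    rw [this]
    refine ofReal_le_distortion (A := Subtype.val ⁻¹' A) (B := Subtype.val ⁻¹' B) ?_ ?_ ?_ ?_ hR
    · rw [← preimage_union, hAB, Subtype.coe_preimage_self]
    · obtain ⟨x, hx⟩ := hA; exact ⟨⟨x, hAX hx⟩, hx⟩
    · obtain ⟨x, hx⟩ := hB; exact ⟨⟨x, hBX hx⟩, hx⟩
    · intro p hp q hq
      have h1 := infDist_le_dist_of_mem (x := a) p.2
      have h2 := infDist_le_dist_of_mem (x := a) q.2
      have h3 := hsep p hp q hq
      rw [dist_comm (p : T) a] at h3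
      rw [Subtype.dist_eq]
      linarith
  calc infEDist a X = 1 / 2 * (2 * infEDist a X) := by
        rw [← mul_assoc, one_div, ENNReal.inv_mul_cancel two_ne_zero ENNReal.ofNat_ne_top, one_mul]
    _ ≤ ghEDist X T := by unfold ghEDist; gcongr

theorem MetricGraph.IsTree.hausdorffEDist_le_ghEDist {T : Type u} [MetricSpace T]
    {G : MetricGraph.{u, v} T} (hG : G.IsTree) {X : Set T}
    (hbd : relBoundary X = ∅ ∨ ((relBoundary X).Nonempty ∧
      orientedHausdorffEDist (relBoundary X) X < hausdorffEDist X univ)) :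
    hausdorffEDist X univ ≤ ghEDist X T := by
  have hle : hausdorffEDist X univ ≤
      max (ghEDist X T) (orientedHausdorffEDist (relBoundary X) X) := by
    refine hausdorffEDist_le_of_infEDist
      (fun x _ => (infEDist_zero_of_mem (mem_univ x)).trans_le bot_le) fun a _ => ?_
    by_cases haX : a ∈ X
    · exact (infEDist_zero_of_mem haX).trans_le bot_le
    by_cases ha : a ∈ relInterior X
    · exact (hG.infEDist_le_ghEDist ha).trans (le_max_left _ _)
    · exact le_max_of_le_right (le_iSup₂ (f := fun b (_ : b ∈ relBoundary X) => infEDist b X) a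
        ⟨haX, ha⟩)
  rcases hbd with h | ⟨-, h⟩
  · simpa [h, orientedHausdorffEDist] using hle
  · exact (le_max_iff.1 hle).resolve_right (not_le.2 h)

/-! ### The canonical Hausdorff geodesic -/

theorem canonicalHausdorffGeodesic_univ {Z : Type u} [MetricSpace Z] (X : Set Z) (t : ℝ) :
    canonicalHausdorffGeodesic X univ t = cthickening t X := by
  rw [canonicalHausdorffGeodesic, univ_subset_iff.1 (self_subset_cthickening univ), inter_univ]

theorem MetricGraph.ghEDist_cthickening_le {T : Type u} [MetricSpace T] (G : MetricGraph.{u, v} T)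
    (X : Set T) {s t : ℝ} (hs : 0 ≤ s) (hst : s ≤ t) :
    ghEDist (cthickening s X) (cthickening t X) ≤ ENNReal.ofReal (t - s) := by
  refine ENNReal.le_of_forall_pos_le_add fun ε hε _ => ?_
  rw [← ENNReal.ofReal_coe_nnreal, ← ENNReal.ofReal_add (sub_nonneg.2 hst) ε.coe_nonneg]
  have hε' : (0 : ℝ) < ε := hε
  refine ghEDist_le_of_forall_exists_dist_le
    (fun x hx => ⟨x, cthickening_mono hst X hx, by simp; linarith⟩) fun y hy => ?_
  have hy' : infEDist y X < ENNReal.ofReal (t + ε) :=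
    (mem_cthickening_iff.1 hy).trans_lt
      ((ENNReal.ofReal_lt_ofReal_iff (by linarith)).2 (by linarith))
  obtain ⟨x, hx, hyx⟩ := infEDist_lt_iff.1 hy'
  rw [edist_lt_ofReal] at hyx
  -- A nearest point of `X` may not exist, hence the slack `ε`. For `s = 0` the path is not divided
  -- and `x` itself serves.
  rcases hs.eq_or_lt with rfl | hs
  · exact ⟨x, self_subset_cthickening X hx, by rw [dist_comm]; linarith⟩
  · obtain ⟨z, hz, hz'⟩ := G.exists_dist_lt_dist_lt y x (a := t - s + ε) (b := s) (by linarith) hs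
      (by linarith)
    exact ⟨z, mem_cthickening_of_dist_le z x s X hx hz'.le, by rw [dist_comm]; exact hz.le⟩

/-! ### The main theorem -/

theorem mainTheorem5 {T : Type u} [MetricSpace T] [Nonempty T] (G : MetricGraph.{u, v} T)
    (hG : G.IsTree) (hdeg : ∀ x ∈ G.vertices, G.degree x < ⊤)
    (X : Set T) (hXne : X.Nonempty) (hXclosed : IsClosed X)
    (hfin : hausdorffEDist X univ < ∞)
    (hbd : relBoundary X = ∅ ∨ ((relBoundary X).Nonempty ∧
      orientedHausdorffEDist (relBoundary X) X < hausdorffEDist X univ)) :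
    ∃ γ : Icc (0 : ℝ) (hausdorffDist X univ) → Cloud T,
      (∀ t : Icc (0 : ℝ) (hausdorffDist X univ),
        ∃ h : (canonicalHausdorffGeodesic X univ (t : ℝ)).Nonempty,
          (γ t : GHClass.{u}) = GHClass.ofSet (canonicalHausdorffGeodesic X univ (t : ℝ)) h) ∧
      (γ ⟨0, left_mem_Icc.2 hausdorffDist_nonneg⟩ : GHClass.{u}) = GHClass.ofSet X hXne ∧
      (γ ⟨hausdorffDist X univ, right_mem_Icc.2 hausdorffDist_nonneg⟩ : GHClass.{u}) =
        SeparationQuotient.mk (MetricSp.mk T) ∧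
      IsShortestCurve hausdorffDist_nonneg γ := by
  set d := hausdorffDist X univ with hd
  have hdE : ENNReal.ofReal d = hausdorffEDist X univ := ENNReal.ofReal_toReal hfin.ne
  have hne : ∀ t : ℝ, (canonicalHausdorffGeodesic X univ t).Nonempty := fun t => by
    rw [canonicalHausdorffGeodesic_univ]
    exact hXne.mono (self_subset_cthickening X)
  have hCd : canonicalHausdorffGeodesic X univ d = univ := by
    rw [canonicalHausdorffGeodesic_univ]
    refine eq_univ_of_forall fun x => ?_
    rw [mem_cthickening_iff, hdE, hausdorffEDist_comm]
    exact infEDist_le_hausdorffEDist_of_mem (mem_univ x)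
  have hC0 : canonicalHausdorffGeodesic X univ 0 = X := by
    rw [canonicalHausdorffGeodesic_univ, cthickening_zero, hXclosed.closure_eq]
  -- The subtype of `univ` and `T` are different types; they agree only as classes at distance zero.
  have hmk : ∀ (S : Set T) (h : S.Nonempty), S = univ →
      GHClass.ofSet S h = SeparationQuotient.mk (MetricSp.mk T) := by
    rintro S h rfl
    rw [GHClass.ofSet, SeparationQuotient.mk_eq_mk, EMetric.inseparable_iff]
    exact ghEDist_univ T
  let c : ℝ → GHClass.{u} := fun t => GHClass.ofSet (canonicalHausdorffGeodesic X univ t) (hne t)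
  have hlip : ∀ s t : Icc (0 : ℝ) d, edist (c s) (c t) ≤ edist s t := by
    intro s t
    wlog hst : s ≤ t generalizing s t
    · rw [edist_comm, edist_comm s]
      exact this t s (le_of_not_ge hst)
    have h := G.ghEDist_cthickening_le X s.2.1 (Subtype.coe_le_coe.2 hst)
    rw [← canonicalHausdorffGeodesic_univ, ← canonicalHausdorffGeodesic_univ] at h
    rw [edist_comm s, Subtype.edist_eq, edist_dist, Real.dist_eq,
      abs_of_nonneg (sub_nonneg.2 (Subtype.coe_le_coe.2 hst))]
    exact (SeparationQuotient.edist_mk _ _).trans_le h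
  have hd0 : 0 ≤ d := hausdorffDist_nonneg
  have hcd : c d = SeparationQuotient.mk (MetricSp.mk T) := hmk _ _ hCd
  have hc0 : c 0 = GHClass.ofSet X hXne := by
    simp only [c, hC0]
  have hcloud : ∀ t : Icc (0 : ℝ) d,
      edist (c t) (SeparationQuotient.mk (MetricSp.mk T)) < ∞ := fun t => by
    rw [← hcd]
    -- Membership in the cloud comes from the Lipschitz bound to the endpoint `C_d = T`.
    exact (hlip t ⟨d, right_mem_Icc.2 hd0⟩).trans_lt (edist_lt_top _ _)
  let γ : Icc (0 : ℝ) d → Cloud T := fun t => ⟨c t, hcloud t⟩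
  have hγ : LipschitzWith 1 γ := fun s t => by
    rw [ENNReal.coe_one, one_mul]
    exact hlip s t
  have hends : ENNReal.ofReal d ≤
      edist (γ ⟨0, left_mem_Icc.2 hd0⟩) (γ ⟨d, right_mem_Icc.2 hd0⟩) := by
    rw [Subtype.edist_eq]
    change _ ≤ edist (c 0) (c d)
    rw [hcd, hc0, hdE]
    exact (hG.hausdorffEDist_le_ghEDist hbd).trans_eq
      (SeparationQuotient.edist_mk (MetricSp.ofSet X hXne) (MetricSp.mk T)).symm
  have hlen : curveLength γ ≤ ENNReal.ofReal d := by
    have h1 : eVariationOn (γ ∘ id) univ ≤ (1 : NNReal) *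
        eVariationOn (id : Icc (0 : ℝ) d → _) univ :=
      (hγ.lipschitzOnWith (s := univ)).comp_eVariationOn_le (mapsTo_univ _ _)
    refine h1.trans ?_
    rw [ENNReal.coe_one, one_mul]
    -- The interval carries the metric of `ℝ`, so the variation of `id` is that of the monotone
    -- inclusion, namely `d - 0`.
    have h2 : eVariationOn (Subtype.val : Icc (0 : ℝ) d → ℝ) univ ≤ ENNReal.ofReal (d - 0) := by
      have hmono : MonotoneOn (Subtype.val : Icc (0 : ℝ) d → ℝ) univ := fun _ _ _ _ h => h
      have h3 := (hmono.eVariationOn_eq (mem_univ ⟨0, left_mem_Icc.2 hd0⟩)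
        (mem_univ ⟨d, right_mem_Icc.2 hd0⟩)).le
      rwa [univ_inter, eq_univ_of_forall fun t : Icc (0 : ℝ) d => mem_Icc.2 ⟨t.2.1, t.2.2⟩] at h3
    rw [sub_zero] at h2
    exact h2
  have hge : ∀ {a' b' : ℝ} (hab' : a' ≤ b') (η : Icc a' b' → Cloud T),
      edist (η ⟨a', left_mem_Icc.2 hab'⟩) (η ⟨b', right_mem_Icc.2 hab'⟩) ≤ curveLength η :=
    fun hab' η => eVariationOn.edist_le η (mem_univ _) (mem_univ _)
  refine ⟨γ, fun t => ⟨hne t, rfl⟩, hc0, hcd, hγ.continuous,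
    le_antisymm (hlen.trans hends) (hge hd0 γ), fun {a' b'} hab' η _ h0 h1 => ?_⟩
  refine (hlen.trans hends).trans ?_
  rw [← h0, ← h1]
  exact hge hab' η
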